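/- For a finite simple graph $H$ with $d(H)$ vertices and $e(H)$ edges, let $c_4(H)$ denote the number of $4$-cycles of $H$, i.e. of (not necessarily induced) subgraphs of $H$ isomorphic to the cycle $C_4$. Let $G$ be a finite connected simple graph with $d \ge 6$ vertices and $e$ edges that has at least one odd cycle. Let $\delta$ and $\Delta$ denote the minimum and the maximum degree of $G$, and suppose that $\delta \ge 2$. Suppose that $$c_4(G') \le \binom{e(G')-d(G')+1}{2}$$ holds for every connected graph $G'$ that has at least one odd cycle and is obtained from $G$ by deleting either a single vertex (together with the edges incident with it) or a single edge (keeping all vertices). If $G$ satisfies at least one of (i) $\Delta = d-1$; (ii) $\delta \ge 3$ and $e < \delta(d-\delta)$; (iii) $e \ge \dfrac{(\delta+2)d-(3\delta+1)}{2} + \dfrac{1}{2(\delta-1)}$; (iv) $\delta \le 3$; then $$c_4(G) \le \binom{e-d+1}{2}.$$ -/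

import Mathlib

namespace SimpleGraph

/-- The number of `4`-cycles of a finite simple graph `H`, i.e. the number of (not necessarily
induced) subgraphs of `H` that are isomorphic to the cycle `C₄`. -/
noncomputable def fourCycleCount {W : Type*} [Fintype W] (H : SimpleGraph W) : ℕ :=
  H.copyCount (cycleGraph 4)

/-- `H` has at least one odd cycle. -/
def HasOddCycle {W : Type*} (H : SimpleGraph W) : Prop :=
  ∃ (w : W) (c : H.Walk w w), c.IsCycle ∧ Odd c.length

/-- A connected graph with `d` vertices has at least `d - 1` edges, so the cyclomatic number
`e - d + 1`, written `e + 1 - d`, does not truncate for connected graphs. -/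
theorem card_le_ncard_edgeSet_add_one {W : Type*} [Fintype W] {H : SimpleGraph W}
    (h : H.Connected) : Fintype.card W ≤ H.edgeSet.ncard + 1 := by
  simpa [Nat.card_eq_fintype_card] using h.card_vert_le_card_edgeSet_add_one

/-- The inequality `c₄(H) ≤ binom(e - d + 1, 2)`, where `H` has `d` vertices and `e` edges.
It is only used for connected `H`, where the subtraction below does not truncate. -/
def FourCycleBound {W : Type*} [Fintype W] (H : SimpleGraph W) : Prop :=
  H.fourCycleCount ≤ (H.edgeSet.ncard + 1 - Fintype.card W).choose 2

end SimpleGraph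

/-! Deleting a suitable edge or vertex loses no more 4-cycles than the bound loses. Call `e - d + 1`
the cyclomatic number.

Edge `uv` on a 4-cycle: deleting it preserves connectedness and an odd cycle and lowers the
cyclomatic number by 1, so at most `e - d` lost 4-cycles are affordable. A connected spanning
subgraph, with at least `d - 1` edges, survives removal of all edges opposite to `uv` in 4-cycles
and all edges within a distance level from `u`. Counting what is removed gives the bound unless `u`
and `v` have at least three common neighbours, two of them adjacent
(`fourCycleBound_or_commonNbrs`).

If every edge on a 4-cycle is of this exceptional kind, any 4-cycle yields a `K₄`, so an odd cycle
survives the deletion of any vertex. Counting the 4-cycles through `w` by the vertex opposite to `w`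
turns deletion of a non-cut vertex `w` into a degree inequality (`two_mul_sum_choose_two_le`). A
non-cut vertex of least degree, or else some non-cut vertex on no 4-cycle, finishes the proof. -/

namespace SimpleGraph

/-! ### Odd cycles and 2-colourability -/

section OddCycle

variable {V : Type*} {G : SimpleGraph V}

theorem Walk.IsPath.isCycle_cons_of_two_le_length {u v : V} {p : G.Walk v u} (hp : p.IsPath)
    (h : G.Adj u v) (hl : 2 ≤ p.length) : (Walk.cons h p).IsCycle := by
  rw [Walk.cons_isCycle_iff]
  refine ⟨hp, fun hmem => ?_⟩
  cases p with
  | nil => simp at hl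
  | cons h' q =>
    rw [Walk.cons_isPath_iff] at hp
    rw [Walk.edges_cons, List.mem_cons] at hmem
    rcases hmem with hmem | hmem
    · rw [Sym2.eq_swap, Sym2.congr_right] at hmem
      subst hmem
      have := Walk.eq_nil_iff_nil.2 (Walk.isPath_iff_nil.1 hp.1)
      subst this
      simp at hl
    · exact hp.2 (q.snd_mem_support_of_mem_edges hmem)

/-- Each closed segment cut out by `bypass` is an edge followed by a path back. It is either an edge
traversed twice or a genuine cycle, so it changes parity only if it is an odd cycle. -/
theorem hasOddCycle_or_length_bypass_mod_two [DecidableEq V] {u v : V} (p : G.Walk u v) :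
    G.HasOddCycle ∨ p.length % 2 = p.bypass.length % 2 := by
  induction p with
  | nil => simp [Walk.bypass]
  | @cons u v w h p ih =>
    refine or_iff_not_imp_left.2 fun hno => ?_
    have ih := ih.resolve_left hno
    rw [Walk.bypass]
    simp only [Walk.length_cons]
    split_ifs with hs
    · have hlen := congrArg Walk.length (p.bypass.take_spec hs)
      rw [Walk.length_append] at hlen
      have htake : ((p.bypass.takeUntil u hs).length) % 2 = 1 := by
        by_contra hcon
        apply hno
        have hpath := (p.bypass_isPath).takeUntil hs
        have hne : (p.bypass.takeUntil u hs).length ≠ 0 := fun h0 =>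
          h.ne (Walk.eq_of_length_eq_zero h0).symm
        exact ⟨u, Walk.cons h _, hpath.isCycle_cons_of_two_le_length h (by omega), by
          rw [Walk.length_cons, Nat.odd_iff]; omega⟩
      omega
    · rw [Walk.length_cons]; omega

theorem hasOddCycle_iff_not_colorable_two : G.HasOddCycle ↔ ¬ G.Colorable 2 := by
  classical
  rw [two_colorable_iff_forall_loop_even]
  constructor
  · rintro ⟨w, c, -, hc⟩ h
    exact Nat.not_even_iff_odd.2 hc (h w c)
  · intro h
    push Not at h
    obtain ⟨u, p, hp⟩ := h
    refine (hasOddCycle_or_length_bypass_mod_two p).resolve_right fun h => ?_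
    have := Walk.eq_nil_iff_nil.2 (Walk.isPath_iff_nil.1 p.bypass_isPath)
    rw [this, Walk.length_nil] at h
    exact hp (Nat.even_iff.2 h)

theorem hasOddCycle_of_triangle {a b c : V} (hab : G.Adj a b) (hbc : G.Adj b c)
    (hca : G.Adj c a) : G.HasOddCycle := by
  rw [hasOddCycle_iff_not_colorable_two, two_colorable_iff_forall_loop_even]
  intro h
  have := h a (.cons hab (.cons hbc (.cons hca .nil)))
  simp [Nat.even_iff] at this

end OddCycle

/-! ### 4-cycles as vertex quadruples and as edge sets -/

section FourCycles

variable {V : Type*}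

/-- `a b c d` are the successive vertices of a `4`-cycle of `G`. -/
def IsFourCycle (G : SimpleGraph V) (a b c d : V) : Prop :=
  G.Adj a b ∧ G.Adj b c ∧ G.Adj c d ∧ G.Adj d a ∧ a ≠ c ∧ b ≠ d

/-- The edges of the closed walk `a b c d`. -/
def fourCycleEdges (a b c d : V) : Set (Sym2 V) := {s(a, b), s(b, c), s(c, d), s(d, a)}

/-- The edge sets of the `4`-cycles of `G`. -/
def fourCycleSets (G : SimpleGraph V) : Set (Set (Sym2 V)) :=
  {E | ∃ a b c d, G.IsFourCycle a b c d ∧ E = fourCycleEdges a b c d}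

variable {G : SimpleGraph V}

theorem IsFourCycle.rotate {a b c d : V} (h : G.IsFourCycle a b c d) : G.IsFourCycle b c d a :=
  ⟨h.2.1, h.2.2.1, h.2.2.2.1, h.1, h.2.2.2.2.2, h.2.2.2.2.1.symm⟩

theorem IsFourCycle.reflect {a b c d : V} (h : G.IsFourCycle a b c d) : G.IsFourCycle b a d c :=
  ⟨h.1.symm, h.2.2.2.1.symm, h.2.2.1.symm, h.2.1.symm, h.2.2.2.2.2, h.2.2.2.2.1⟩

theorem fourCycleEdges_rotate (a b c d : V) : fourCycleEdges b c d a = fourCycleEdges a b c d := by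
  unfold fourCycleEdges
  ext e
  simp only [Set.mem_insert_iff, Set.mem_singleton_iff]
  tauto

theorem fourCycleEdges_reflect (a b c d : V) : fourCycleEdges b a d c = fourCycleEdges a b c d := by
  unfold fourCycleEdges
  ext e
  simp only [Set.mem_insert_iff, Set.mem_singleton_iff, Sym2.eq_swap (a := b) (b := a),
    Sym2.eq_swap (a := a) (b := d), Sym2.eq_swap (a := d) (b := c), Sym2.eq_swap (a := c) (b := b)]
  tauto

theorem Copy.edgeSet_toSubgraph_cycleGraph_four (f : Copy (cycleGraph 4) G) :
    f.toSubgraph.edgeSet = fourCycleEdges (f 0) (f 1) (f 2) (f 3) := by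
  ext e
  induction e with
  | h x y =>
    simp only [Subgraph.mem_edgeSet, Subgraph.map_adj, Relation.Map, Subgraph.top_adj,
      cycleGraph_adj, fourCycleEdges, Set.mem_insert_iff, Set.mem_singleton_iff, Sym2.eq_iff]
    constructor
    · rintro ⟨i, j, hij, rfl, rfl⟩
      fin_cases i <;> fin_cases j <;> first
        | exact absurd hij (by decide)
        | simp
    · rintro ((⟨rfl, rfl⟩ | ⟨rfl, rfl⟩) | (⟨rfl, rfl⟩ | ⟨rfl, rfl⟩) | (⟨rfl, rfl⟩ | ⟨rfl, rfl⟩) |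
        (⟨rfl, rfl⟩ | ⟨rfl, rfl⟩)) <;> exact ⟨_, _, by decide, rfl, rfl⟩

theorem Copy.isFourCycle (f : Copy (cycleGraph 4) G) :
    G.IsFourCycle (f 0) (f 1) (f 2) (f 3) :=
  ⟨f.toHom.map_adj (by rw [cycleGraph_adj]; decide),
    f.toHom.map_adj (by rw [cycleGraph_adj]; decide),
    f.toHom.map_adj (by rw [cycleGraph_adj]; decide),
    f.toHom.map_adj (by rw [cycleGraph_adj]; decide),
    f.injective.ne (by decide), f.injective.ne (by decide)⟩

/-- The copy of `cycleGraph 4` spanned by a `4`-cycle. -/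
def IsFourCycle.copy {a b c d : V} (h : G.IsFourCycle a b c d) : Copy (cycleGraph 4) G where
  toHom :=
    { toFun := ![a, b, c, d]
      map_rel' := by
        intro i j hij
        obtain ⟨h1, h2, h3, h4, -, -⟩ := h
        rw [cycleGraph_adj] at hij
        fin_cases i <;> fin_cases j <;> first
          | exact absurd hij (by decide)
          | simp [h1, h2, h3, h4, h1.symm, h2.symm, h3.symm, h4.symm] }
  injective' := by
    obtain ⟨h1, h2, h3, h4, h5, h6⟩ := h
    intro i j hij
    fin_cases i <;> fin_cases j <;> first
      | rfl
      | simp [h1.ne, h2.ne, h3.ne, h4.ne, h5, h6, h1.ne', h2.ne', h3.ne', h4.ne', h5.symm,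
          h6.symm] at hij

/-- A copy of `C₄` has no isolated vertices, so its edge set determines it as a subgraph. -/
theorem fourCycleCount_eq_ncard [Fintype V] (G : SimpleGraph V) :
    G.fourCycleCount = G.fourCycleSets.ncard := by
  classical
  have himage : G.fourCycleSets =
      Subgraph.edgeSet '' (Set.range (Copy.toSubgraph (A := cycleGraph 4) (B := G))) := by
    ext E
    constructor
    · rintro ⟨a, b, c, d, h, rfl⟩
      exact ⟨_, ⟨h.copy, rfl⟩, Copy.edgeSet_toSubgraph_cycleGraph_four _⟩
    · rintro ⟨_, ⟨f, rfl⟩, rfl⟩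
      exact ⟨_, _, _, _, f.isFourCycle, f.edgeSet_toSubgraph_cycleGraph_four⟩
  have hverts : ∀ f : Copy (cycleGraph 4) G, ∀ v, v ∈ f.toSubgraph.verts ↔
      ∃ w, f.toSubgraph.Adj v w := by
    intro f v
    constructor
    · rintro ⟨i, -, rfl⟩
      exact ⟨f (i + 1), i, i + 1, by
        rw [Subgraph.top_adj, cycleGraph_adj]; simp, rfl, rfl⟩
    · rintro ⟨w, hw⟩
      exact hw.fst_mem
  have hinj : Set.InjOn Subgraph.edgeSet
      (Set.range (Copy.toSubgraph (A := cycleGraph 4) (B := G))) := by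
    rintro _ ⟨f, rfl⟩ _ ⟨g, rfl⟩ hfg
    have hadj : ∀ v w, f.toSubgraph.Adj v w ↔ g.toSubgraph.Adj v w := fun v w => by
      rw [← Subgraph.mem_edgeSet, ← Subgraph.mem_edgeSet, hfg]
    refine Subgraph.ext ?_ (by ext v w; exact hadj v w)
    ext v
    simp only [hverts, hadj]
  rw [himage, hinj.ncard_image, fourCycleCount, copyCount,
    Copy.range_toSubgraph, Set.ncard_eq_toFinset_card']
  simp

end FourCycles

/-! ### Deleting an edge of a 4-cycle -/

section EdgeDeletion

variable {V : Type*} {G : SimpleGraph V}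

theorem Connected.exists_adj_dist_eq_add_one (hG : G.Connected) {u w : V} (h : w ≠ u) :
    ∃ p, G.Adj p w ∧ G.dist u w = G.dist u p + 1 := by
  obtain ⟨q, hq⟩ := hG.exists_walk_length_eq_dist w u
  cases q with
  | nil => exact absurd rfl h
  | @cons _ p _ hp q =>
    refine ⟨p, hp.symm, ?_⟩
    have h1 : G.dist u p ≤ q.length := by rw [dist_comm]; exact dist_le q
    have h2 := hG.dist_triangle (u := u) (v := p) (w := w)
    rw [dist_eq_one_iff_adj.2 hp.symm] at h2
    rw [Walk.length_cons, dist_comm] at hq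
    omega

/-- Distances of adjacent vertices differ by at most 1; were they never equal, the parity of the
distance from `u` would be a 2-colouring. -/
theorem Connected.exists_adj_dist_eq (hG : G.Connected) (hodd : G.HasOddCycle) (u : V) :
    ∃ x y, G.Adj x y ∧ G.dist u x = G.dist u y := by
  by_contra! hcon
  rw [hasOddCycle_iff_not_colorable_two] at hodd
  refine hodd ⟨Coloring.mk (fun v => (⟨G.dist u v % 2, Nat.mod_lt _ (by norm_num)⟩ : Fin 2)) ?_⟩
  intro x y hxy heq
  have h1 := hcon x y hxy
  have h2 := hG.dist_triangle (u := u) (v := x) (w := y)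
  have h3 := hG.dist_triangle (u := u) (v := y) (w := x)
  rw [dist_eq_one_iff_adj.2 hxy] at h2
  rw [dist_eq_one_iff_adj.2 hxy.symm] at h3
  rw [Fin.mk.injEq] at heq
  omega

theorem IsFourCycle.exists_of_mem_edges {a b c d u v : V} (h : G.IsFourCycle a b c d)
    (huv : s(u, v) ∈ fourCycleEdges a b c d) :
    ∃ y x, G.IsFourCycle u v y x ∧ fourCycleEdges a b c d = fourCycleEdges u v y x := by
  have key : ∀ {a b c d : V}, G.IsFourCycle a b c d → s(u, v) = s(a, b) →
      ∃ y x, G.IsFourCycle u v y x ∧ fourCycleEdges a b c d = fourCycleEdges u v y x := by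
    intro a b c d h heq
    rw [Sym2.eq_iff] at heq
    rcases heq with ⟨rfl, rfl⟩ | ⟨rfl, rfl⟩
    · exact ⟨_, _, h, rfl⟩
    · exact ⟨_, _, h.reflect, (fourCycleEdges_reflect _ _ _ _).symm⟩
  simp only [fourCycleEdges, Set.mem_insert_iff, Set.mem_singleton_iff] at huv
  rcases huv with huv | huv | huv | huv
  · exact key h huv
  · rw [← fourCycleEdges_rotate]; exact key h.rotate huv
  · rw [← fourCycleEdges_rotate, ← fourCycleEdges_rotate]; exact key h.rotate.rotate huv
  · rw [← fourCycleEdges_rotate, ← fourCycleEdges_rotate, ← fourCycleEdges_rotate]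
    exact key h.rotate.rotate.rotate huv

theorem Connected.deleteEdges_of_isFourCycle (hG : G.Connected) {u v y x : V}
    (h : G.IsFourCycle u v y x) : (G.deleteEdges {s(u, v)}).Connected := by
  refine hG.connected_delete_edge_of_not_isBridge ?_
  rw [isBridge_iff, not_not]
  obtain ⟨h1, h2, h3, h4, h5, h6⟩ := h
  have a1 : (G.deleteEdges {s(u, v)}).Adj u x := by
    simp [deleteEdges_adj, h4.symm, h6.symm, h1.ne]
  have a2 : (G.deleteEdges {s(u, v)}).Adj x y := by
    simp [deleteEdges_adj, h3.symm, h4.ne, h5.symm]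
  have a3 : (G.deleteEdges {s(u, v)}).Adj y v := by
    simp [deleteEdges_adj, h2.symm, h5.symm, h1.ne']
  exact a1.reachable.trans (a2.reachable.trans a3.reachable)

/-- The remaining path `u x y v` has odd length, so any 2-colouring without `uv` separates `u` from
`v` and is also proper for `G`. -/
theorem HasOddCycle.deleteEdges_of_isFourCycle (hodd : G.HasOddCycle) {u v y x : V}
    (h : G.IsFourCycle u v y x) : (G.deleteEdges {s(u, v)}).HasOddCycle := by
  rw [hasOddCycle_iff_not_colorable_two] at *
  rintro ⟨c⟩
  refine hodd ⟨Coloring.mk c ?_⟩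
  obtain ⟨h1, h2, h3, h4, h5, h6⟩ := h
  have a1 : c u ≠ c x := c.valid (by simp [deleteEdges_adj, h4.symm, h6.symm, h1.ne])
  have a2 : c x ≠ c y := c.valid (by simp [deleteEdges_adj, h3.symm, h4.ne, h5.symm])
  have a3 : c y ≠ c v := c.valid (by simp [deleteEdges_adj, h2.symm, h5.symm, h1.ne'])
  have a4 : c u ≠ c v := by omega
  intro a b hab
  by_cases he : s(a, b) = s(u, v)
  · rw [Sym2.eq_iff] at he
    rcases he with ⟨rfl, rfl⟩ | ⟨rfl, rfl⟩
    · exact a4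
    · exact a4.symm
  · exact c.valid (by simp only [deleteEdges_adj, Set.mem_singleton_iff]; exact ⟨hab, he⟩)

variable [Fintype V]

open Classical in
/-- The ordered pairs of adjacent vertices. -/
noncomputable def adjPairs (G : SimpleGraph V) : Finset (V × V) := {p | G.Adj p.1 p.2}

theorem card_adjPairs (G : SimpleGraph V) : G.adjPairs.card = 2 * G.edgeSet.ncard := by
  classical
  rw [Set.ncard_eq_toFinset_card', ← edgeFinset, ← sum_degrees_eq_twice_card_edges]
  rw [Finset.card_eq_sum_card_fiberwise (f := Prod.fst) (t := Finset.univ) (by simp)]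
  refine Finset.sum_congr rfl fun v _ => ?_
  rw [← card_neighborFinset_eq_degree]
  refine Finset.card_nbij' Prod.snd (fun w => (v, w)) ?_ ?_ ?_ ?_
  · rintro ⟨a, b⟩; simp only [adjPairs, Finset.coe_filter, Finset.mem_filter]; aesop
  · intro b; simp [adjPairs]
  · rintro ⟨a, b⟩; simp only [adjPairs, Finset.coe_filter, Finset.mem_filter]; aesop
  · intro b; simp

open Classical in
/-- The pairs `(x, y)` such that `u v y x` is a `4`-cycle. -/
noncomputable def fourCyclePairs (G : SimpleGraph V) (u v : V) : Finset (V × V) :=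
  {p | G.IsFourCycle u v p.2 p.1}

open Classical in
/-- The common neighbours of two vertices. -/
noncomputable def commonNbrs (G : SimpleGraph V) (u v : V) : Finset V :=
  {x | G.Adj u x ∧ G.Adj v x}

open Classical in
/-- The ordered pairs of adjacent common neighbours of two vertices. -/
noncomputable def commonAdjPairs (G : SimpleGraph V) (u v : V) : Finset (V × V) :=
  {p | p.1 ∈ G.commonNbrs u v ∧ p.2 ∈ G.commonNbrs u v ∧ G.Adj p.1 p.2}

theorem card_commonAdjPairs_add_le (G : SimpleGraph V) (u v : V) :
    (G.commonAdjPairs u v).card + (G.commonNbrs u v).card ≤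
      (G.commonNbrs u v).card * (G.commonNbrs u v).card := by
  classical
  have h1 : G.commonAdjPairs u v ⊆ (G.commonNbrs u v).offDiag := by
    rintro ⟨x, y⟩ h
    simp only [commonAdjPairs, Finset.mem_filter, Finset.mem_univ, true_and] at h
    exact Finset.mem_offDiag.2 ⟨h.1, h.2.1, h.2.2.ne⟩
  have h2 := Finset.card_le_card h1
  rw [Finset.offDiag_card] at h2
  have := Nat.le_mul_self (G.commonNbrs u v).card
  omega

/-- Ordered adjacent pairs are counted, hence the factors 2. An opposite edge is counted in both
orientations by `fourCyclePairs` only when its ends are common neighbours of `u` and `v`;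
`commonAdjPairs` corrects for this. `X` collects further discarded edges, each inside one distance
level. -/
theorem Connected.two_mul_card_fourCyclePairs_add_le (hG : G.Connected) {u v : V}
    (huv : G.Adj u v) (X : Finset (V × V))
    (hX : ∀ p ∈ X, G.Adj p.1 p.2 ∧ G.dist u p.1 = G.dist u p.2 ∧
      ¬ G.IsFourCycle u v p.1 p.2 ∧ ¬ G.IsFourCycle u v p.2 p.1) :
    2 * (G.fourCyclePairs u v).card + X.card + 2 * Fintype.card V ≤
      2 * G.edgeSet.ncard + 2 + (G.commonAdjPairs u v).card := by
  classical
  -- `H` keeps the edges that join different levels and are not opposite to `uv`.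
  let H : SimpleGraph V :=
    { Adj := fun x y => G.Adj x y ∧ G.dist u x ≠ G.dist u y ∧ ¬ G.IsFourCycle u v x y ∧
        ¬ G.IsFourCycle u v y x
      symm := ⟨fun x y h => ⟨h.1.symm, h.2.1.symm, h.2.2.2, h.2.2.1⟩⟩
      loopless := ⟨fun x h => h.2.1 rfl⟩ }
  have hu1 : ∀ w, G.Adj u w → H.Adj u w := fun w hw => by
    refine ⟨hw, ?_, fun h => h.2.2.2.2.1 rfl, fun h => h.2.2.2.1.ne rfl⟩
    rw [dist_self, dist_eq_one_iff_adj.2 hw]; norm_num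
  have hH : H.Connected := by
    rw [connected_iff_exists_forall_reachable]
    refine ⟨u, fun w => ?_⟩
    -- Edges at `u` or `v` are never opposite to `uv`. A vertex adjacent to neither is an end of no
    -- opposite edge, so its edge towards `u` along a geodesic survives.
    induction hn : G.dist u w using Nat.strong_induction_on generalizing w with
    | _ n ih =>
      by_cases hwu : w = u
      · rw [hwu]
      by_cases huw : G.Adj u w
      · exact (hu1 w huw).reachable
      by_cases hvw : G.Adj v w
      · refine (hu1 v huv).reachable.trans (Adj.reachable ⟨hvw, ?_, fun h => h.2.1.ne rfl,
          fun h => h.2.2.2.2.2 rfl⟩)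
        rw [dist_eq_one_iff_adj.2 huv]
        exact fun h => huw (dist_eq_one_iff_adj.1 h.symm)
      · obtain ⟨p, hpw, hp⟩ := hG.exists_adj_dist_eq_add_one hwu
        refine (ih _ (by omega) p rfl).trans (Adj.reachable ⟨hpw, by omega, ?_, ?_⟩)
        · exact fun h => huw h.2.2.2.1.symm
        · exact fun h => hvw h.2.1
  have hHcard := card_le_ncard_edgeSet_add_one hH
  set P := G.fourCyclePairs u v with hPdef
  set Q := P.image Prod.swap with hQdef
  have hP : ∀ p, p ∈ P ↔ G.IsFourCycle u v p.2 p.1 := by simp [hPdef, fourCyclePairs]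
  have hQ : ∀ p, p ∈ Q ↔ G.IsFourCycle u v p.1 p.2 := by
    rintro ⟨x, y⟩
    simp [hQdef, hP]
  have hQcard : Q.card = P.card := Finset.card_image_of_injective _ Prod.swap_injective
  have hint : P ∩ Q ⊆ G.commonAdjPairs u v := by
    rintro ⟨x, y⟩ h
    rw [Finset.mem_inter, hP, hQ] at h
    obtain ⟨⟨-, h1, h2, h3, -, -⟩, ⟨-, h4, h5, h6, -, -⟩⟩ := h
    simp only [commonAdjPairs, commonNbrs, Finset.mem_filter, Finset.mem_univ, true_and]
    exact ⟨⟨h3.symm, h4⟩, ⟨h6.symm, h1⟩, h5⟩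
  have hintc := Finset.card_le_card hint
  have hunion := Finset.card_union_add_card_inter P Q
  have hdisj1 : Disjoint (P ∪ Q) X := by
    rw [Finset.disjoint_right]
    intro p hp h
    rw [Finset.mem_union, hP, hQ] at h
    exact h.elim (hX p hp).2.2.2 (hX p hp).2.2.1
  have hdisj2 : Disjoint (P ∪ Q ∪ X) H.adjPairs := by
    rw [Finset.disjoint_right]
    intro p hp h
    simp only [adjPairs, Finset.mem_filter, Finset.mem_univ, true_and] at hp
    rw [Finset.mem_union, Finset.mem_union, hP, hQ] at h
    rcases h with (h | h) | h
    · exact hp.2.2.2 h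
    · exact hp.2.2.1 h
    · exact hp.2.1 (hX p h).2.1
  have hsub : P ∪ Q ∪ X ∪ H.adjPairs ⊆ G.adjPairs := by
    intro p h
    simp only [adjPairs, Finset.mem_filter, Finset.mem_univ, true_and]
    simp only [adjPairs, Finset.mem_union, Finset.mem_filter, Finset.mem_univ, true_and, hP, hQ]
      at h
    rcases h with ((h | h) | h) | h
    · exact h.2.2.1.symm
    · exact h.2.2.1
    · exact (hX p h).1
    · exact h.1
  have hcard := Finset.card_le_card hsub
  rw [Finset.card_union_of_disjoint hdisj2, Finset.card_union_of_disjoint hdisj1,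
    card_adjPairs, card_adjPairs] at hcard
  omega

/-- The edges from `v` to the common neighbours lie in level 1 and are not opposite to `uv`, so they
can serve as `X`. -/
theorem Connected.card_fourCyclePairs_le_of_commonAdjPairs (hG : G.Connected) {u v : V}
    (huv : G.Adj u v)
    (hC : (G.commonAdjPairs u v).card + 2 ≤ 2 * (G.commonNbrs u v).card) :
    (G.fourCyclePairs u v).card + Fintype.card V ≤ G.edgeSet.ncard := by
  classical
  set C := G.commonNbrs u v with hCdef
  have hmem : ∀ x, x ∈ C ↔ G.Adj u x ∧ G.Adj v x := by simp [hCdef, commonNbrs]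
  have hvC : v ∉ C := fun h => ((hmem v).1 h).2.ne rfl
  have hdisj : Disjoint ({v} ×ˢ C) (C ×ˢ {v}) := by
    rw [Finset.disjoint_left]
    rintro ⟨x, y⟩ h1 h2
    simp only [Finset.mem_product, Finset.mem_singleton] at h1 h2
    exact hvC (h1.1 ▸ h2.1)
  have := hG.two_mul_card_fourCyclePairs_add_le huv ({v} ×ˢ C ∪ C ×ˢ {v}) (by
    rintro ⟨x, y⟩ h
    simp only [Finset.mem_union, Finset.mem_product, Finset.mem_singleton, hmem] at h
    rcases h with ⟨rfl, h1, h2⟩ | ⟨⟨h1, h2⟩, rfl⟩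
    · exact ⟨h2, by rw [dist_eq_one_iff_adj.2 huv, dist_eq_one_iff_adj.2 h1],
        fun h => h.2.1.ne rfl, fun h => h.2.2.2.2.2 rfl⟩
    · exact ⟨h2.symm, by rw [dist_eq_one_iff_adj.2 huv, dist_eq_one_iff_adj.2 h1],
        fun h => h.2.2.2.2.2 rfl, fun h => h.2.1.ne rfl⟩)
  rw [Finset.card_union_of_disjoint hdisj, Finset.card_product, Finset.card_product,
    Finset.card_singleton] at this
  omega

/-- Without common neighbours, every opposite edge joins level 1 to another level. The odd cycle
supplies an edge inside a level, and its two orientations form `X`. -/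
theorem Connected.card_fourCyclePairs_le_of_commonNbrs_eq_empty (hG : G.Connected)
    (hodd : G.HasOddCycle) {u v : V} (huv : G.Adj u v) (hC : G.commonNbrs u v = ∅) :
    (G.fourCyclePairs u v).card + Fintype.card V ≤ G.edgeSet.ncard := by
  classical
  have hC' : ∀ x, G.Adj u x → ¬ G.Adj v x := fun x h1 h2 => by
    have : x ∈ G.commonNbrs u v := by simp [commonNbrs, h1, h2]
    simp [hC] at this
  obtain ⟨x, y, hxy, hd⟩ := hG.exists_adj_dist_eq hodd u
  have key : ∀ x y, G.dist u x = G.dist u y → ¬ G.IsFourCycle u v x y := by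
    rintro x y hd ⟨-, h1, -, h2, -, -⟩
    rw [dist_eq_one_iff_adj.2 h2.symm, dist_eq_one_iff_adj] at hd
    exact hC' x hd h1
  have := hG.two_mul_card_fourCyclePairs_add_le huv {(x, y), (y, x)} (by
    rintro p hp
    simp only [Finset.mem_insert, Finset.mem_singleton] at hp
    rcases hp with rfl | rfl
    · exact ⟨hxy, hd, key _ _ hd, key _ _ hd.symm⟩
    · exact ⟨hxy.symm, hd.symm, key _ _ hd.symm, key _ _ hd⟩)
  rw [Finset.card_pair (by simp [hxy.ne])] at this
  have hD : (G.commonAdjPairs u v).card = 0 := by simp [commonAdjPairs, hC]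
  omega

theorem fourCycleCount_le_deleteEdges_add (G : SimpleGraph V) (u v : V) :
    G.fourCycleCount ≤ (G.deleteEdges {s(u, v)}).fourCycleCount + (G.fourCyclePairs u v).card := by
  rw [fourCycleCount_eq_ncard, fourCycleCount_eq_ncard]
  have hsub : G.fourCycleSets ⊆ (G.deleteEdges {s(u, v)}).fourCycleSets ∪
      (fun p : V × V => fourCycleEdges u v p.2 p.1) '' (G.fourCyclePairs u v : Set (V × V)) := by
    rintro E ⟨a, b, c, d, h, rfl⟩
    by_cases huv : s(u, v) ∈ fourCycleEdges a b c d
    · right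
      obtain ⟨y, x, h', heq⟩ := h.exists_of_mem_edges huv
      exact ⟨(x, y), by simpa [fourCyclePairs] using h', heq.symm⟩
    · left
      simp only [fourCycleEdges, Set.mem_insert_iff, Set.mem_singleton_iff, not_or] at huv
      obtain ⟨h1, h2, h3, h4⟩ := huv
      refine ⟨a, b, c, d, ⟨?_, ?_, ?_, ?_, h.2.2.2.2.1, h.2.2.2.2.2⟩, rfl⟩ <;>
        rw [deleteEdges_adj, Set.mem_singleton_iff]
      · exact ⟨h.1, Ne.symm h1⟩
      · exact ⟨h.2.1, Ne.symm h2⟩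
      · exact ⟨h.2.2.1, Ne.symm h3⟩
      · exact ⟨h.2.2.2.1, Ne.symm h4⟩
  refine (Set.ncard_le_ncard hsub (Set.toFinite _)).trans ((Set.ncard_union_le _ _).trans ?_)
  refine Nat.add_le_add_left ((Set.ncard_image_le (Set.toFinite _)).trans ?_) _
  rw [Set.ncard_coe_finset]

theorem ncard_edgeSet_deleteEdges_singleton {u v : V} (h : G.Adj u v) :
    (G.deleteEdges {s(u, v)}).edgeSet.ncard + 1 = G.edgeSet.ncard := by
  rw [edgeSet_deleteEdges]
  exact Set.ncard_sdiff_singleton_add_one (G.mem_edgeSet.2 h) (Set.toFinite _)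

/-- Pascal's rule: passing from `m = e - d` to `m + 1` raises the binomial by exactly `m`. -/
theorem FourCycleBound.of_deleteEdges {u v : V} (h : G.Adj u v)
    (hB : (G.deleteEdges {s(u, v)}).FourCycleBound)
    (hP : (G.fourCyclePairs u v).card + Fintype.card V ≤ G.edgeSet.ncard) :
    G.FourCycleBound := by
  unfold FourCycleBound at *
  have h1 := G.fourCycleCount_le_deleteEdges_add u v
  have h2 := ncard_edgeSet_deleteEdges_singleton h
  obtain ⟨m, hm⟩ := Nat.exists_eq_add_of_le (show Fintype.card V ≤ G.edgeSet.ncard by omega)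
  have h3 : (G.deleteEdges {s(u, v)}).edgeSet.ncard + 1 - Fintype.card V = m := by omega
  have h4 : G.edgeSet.ncard + 1 - Fintype.card V = m + 1 := by omega
  rw [h3] at hB
  have h5 : (m + 1).choose 2 = m + m.choose 2 := by
    rw [Nat.choose_succ_succ' m 1, Nat.choose_one_right]
  rw [h4, h5]
  omega

/-- Either deleting some edge of a `4`-cycle proves the bound, or every edge on a `4`-cycle has
many common neighbours. -/
theorem Connected.fourCycleBound_or_commonNbrs (hG : G.Connected) (hodd : G.HasOddCycle)
    (hedge : ∀ s ∈ G.edgeSet, (G.deleteEdges {s}).Connected →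
      (G.deleteEdges {s}).HasOddCycle → (G.deleteEdges {s}).FourCycleBound) :
    G.FourCycleBound ∨ ∀ u v y x, G.IsFourCycle u v y x →
      3 ≤ (G.commonNbrs u v).card ∧ (G.commonAdjPairs u v).Nonempty := by
  refine or_iff_not_imp_left.2 fun hno u v y x h => ?_
  have hB := hedge _ (G.mem_edgeSet.2 h.1) (hG.deleteEdges_of_isFourCycle h)
    (hodd.deleteEdges_of_isFourCycle h)
  have h1 : ¬ ((G.commonAdjPairs u v).card + 2 ≤ 2 * (G.commonNbrs u v).card) := fun hC =>
    hno (.of_deleteEdges h.1 hB (hG.card_fourCyclePairs_le_of_commonAdjPairs h.1 hC))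
  have h2 : (G.commonNbrs u v).card ≠ 0 := fun hC =>
    hno (.of_deleteEdges h.1 hB (hG.card_fourCyclePairs_le_of_commonNbrs_eq_empty hodd h.1
      (Finset.card_eq_zero.1 hC)))
  -- With `c` common neighbours, `2c - 1 ≤ |commonAdjPairs| ≤ c(c - 1)` and `c ≠ 0` force `c ≥ 3`.
  have h3 := G.card_commonAdjPairs_add_le u v
  rw [← Finset.card_pos]
  generalize (G.commonNbrs u v).card = c at *
  have hc : 3 ≤ c := by
    by_contra hlt
    have : c ≤ 2 := by omega
    interval_cases c <;> omega
  exact ⟨hc, by omega⟩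

end EdgeDeletion

/-! ### Deleting a vertex -/

section VertexDeletion

variable {V : Type*} {G : SimpleGraph V}

/-- A vertex farthest from `w` is interior to no geodesic starting at `w`, so it is not a cut
vertex. -/
theorem Connected.induce_compl_singleton_of_dist_le (hG : G.Connected) {w x : V} (hx : x ≠ w)
    (h : ∀ y, G.dist w y ≤ G.dist w x) : (G.induce ({x}ᶜ : Set V)).Connected := by
  rw [connected_iff_exists_forall_reachable]
  refine ⟨⟨w, by simpa using hx.symm⟩, ?_⟩
  rintro ⟨y, hy⟩
  induction hn : G.dist w y using Nat.strong_induction_on generalizing y with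
  | _ n ih =>
    by_cases hyw : y = w
    · subst hyw; rfl
    · obtain ⟨p, hpy, hp⟩ := hG.exists_adj_dist_eq_add_one hyw
      have hpx : p ∈ ({x}ᶜ : Set V) := by
        rw [Set.mem_compl_singleton_iff]
        rintro rfl
        have := h y
        omega
      refine (ih _ (by omega) p hpx rfl).trans (Adj.reachable ?_)
      simpa using hpy

theorem hasOddCycle_induce_compl_singleton_of_isClique {a b c d : V} (hab : G.Adj a b)
    (hac : G.Adj a c) (had : G.Adj a d) (hbc : G.Adj b c) (hbd : G.Adj b d) (hcd : G.Adj c d)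
    (w : V) : (G.induce ({w}ᶜ : Set V)).HasOddCycle := by
  have key : ∀ {x y z : V}, G.Adj x y → G.Adj y z → G.Adj z x → x ≠ w → y ≠ w → z ≠ w →
      (G.induce ({w}ᶜ : Set V)).HasOddCycle := fun {x y z} h1 h2 h3 hx hy hz =>
    hasOddCycle_of_triangle (a := ⟨x, hx⟩) (b := ⟨y, hy⟩) (c := ⟨z, hz⟩)
      (by simpa using h1) (by simpa using h2) (by simpa using h3)
  by_cases h1 : b = w
  · subst h1; exact key hac hcd had.symm hab.ne hbc.ne' hbd.ne'
  by_cases h2 : c = w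
  · subst h2; exact key hab hbd had.symm hac.ne hbc.ne hcd.ne'
  by_cases h3 : d = w
  · subst h3; exact key hab hbc hac.symm had.ne hbd.ne hcd.ne
  exact key hbc hcd hbd.symm h1 h2 h3

theorem two_mul_choose_two (n : ℕ) : 2 * (n.choose 2 : ℤ) = n * (n - 1) := by
  induction n with
  | zero => simp
  | succ n ih =>
    rw [Nat.choose_succ_succ' n 1, Nat.choose_one_right]
    push_cast
    linarith

variable [Fintype V]

theorem mem_commonNbrs {u v x : V} : x ∈ G.commonNbrs u v ↔ G.Adj u x ∧ G.Adj v x := by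
  simp [commonNbrs]

theorem IsFourCycle.of_mem_commonNbrs {w x b d : V} (hwx : w ≠ x)
    (hb : b ∈ G.commonNbrs w x) (hd : d ∈ G.commonNbrs w x) (hbd : b ≠ d) :
    G.IsFourCycle w b x d := by
  rw [mem_commonNbrs] at hb hd
  exact ⟨hb.1, hb.2.symm, hd.2, hd.1.symm, hwx, hbd⟩

theorem FourCycleBound.of_forall_not_isFourCycle
    (h : ∀ a b c d, ¬ G.IsFourCycle a b c d) : G.FourCycleBound := by
  unfold FourCycleBound
  rw [fourCycleCount_eq_ncard]
  have : G.fourCycleSets = ∅ := by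
    ext E
    simp only [fourCycleSets, Set.mem_ofPred_eq, Set.mem_empty_iff_false, iff_false]
    rintro ⟨a, b, c, d, hE, -⟩
    exact h a b c d hE
  simp [this]

section

variable [DecidableRel G.Adj]

theorem sum_card_commonNbrs (w : V) :
    ∑ x, (G.commonNbrs w x).card = ∑ u ∈ G.neighborFinset w, G.degree u := by
  have h1 : ∀ x, (G.commonNbrs w x).card =
      ∑ u ∈ G.neighborFinset w, if G.Adj u x then 1 else 0 := by
    intro x
    rw [Finset.sum_boole, Nat.cast_id]
    congr 1
    ext u
    simp [mem_commonNbrs, adj_comm]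
  simp_rw [h1]
  rw [Finset.sum_comm]
  refine Finset.sum_congr rfl fun u _ => ?_
  rw [Finset.sum_boole, Nat.cast_id, ← card_neighborFinset_eq_degree]
  congr 1
  ext x
  simp

theorem card_commonNbrs_self (w : V) : (G.commonNbrs w w).card = G.degree w := by
  rw [← card_neighborFinset_eq_degree]
  congr 1
  ext x
  simp [mem_commonNbrs]

theorem card_commonNbrs_le_degree (w x : V) : (G.commonNbrs w x).card ≤ G.degree w := by
  rw [← card_neighborFinset_eq_degree]
  exact Finset.card_le_card fun y hy => by simpa using (mem_commonNbrs.1 hy).1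

end

variable [DecidableEq V]

/-- A 4-cycle through `w` is determined by the vertex `x` opposite to `w` and the pair of common
neighbours of `w` and `x` that it uses. -/
theorem fourCycleCount_le_induce_add (G : SimpleGraph V) (w : V) :
    G.fourCycleCount ≤ (G.induce ({w}ᶜ : Set V)).fourCycleCount +
      ∑ x ∈ Finset.univ.erase w, (G.commonNbrs w x).card.choose 2 := by
  classical
  rw [fourCycleCount_eq_ncard, fourCycleCount_eq_ncard]
  let T : Finset (Σ _ : V, Finset V) :=
    (Finset.univ.erase w).sigma fun x => (G.commonNbrs w x).powersetCard 2
  let star : (Σ _ : V, Finset V) → Set (Sym2 V) := fun q =>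
    {e | ∃ b ∈ q.2, e = s(w, b) ∨ e = s(q.1, b)}
  let lift : Set (Sym2 ({w}ᶜ : Set V)) → Set (Sym2 V) := Set.image (Sym2.map (↑))
  have hT : T.card = ∑ x ∈ Finset.univ.erase w, (G.commonNbrs w x).card.choose 2 := by
    simp [T, Finset.card_sigma, Finset.card_powersetCard]
  have key : ∀ {b x d : V}, G.IsFourCycle w b x d →
      fourCycleEdges w b x d ∈ star '' (T : Set (Σ _ : V, Finset V)) := by
    intro b x d h
    refine ⟨⟨x, {b, d}⟩, ?_, ?_⟩
    · simp only [T, Finset.coe_sigma, Set.mem_sigma_iff, Finset.mem_coe, Finset.mem_erase,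
        Finset.mem_univ, and_true, Finset.mem_powersetCard]
      refine ⟨h.2.2.2.2.1.symm, ?_, Finset.card_pair h.2.2.2.2.2⟩
      intro z hz
      rw [Finset.mem_insert, Finset.mem_singleton] at hz
      rw [mem_commonNbrs]
      rcases hz with rfl | rfl
      · exact ⟨h.1, h.2.1.symm⟩
      · exact ⟨h.2.2.2.1.symm, h.2.2.1⟩
    · ext e
      simp only [star, fourCycleEdges, Finset.mem_insert, Finset.mem_singleton, Set.mem_ofPred_eq,
        exists_eq_or_imp, exists_eq_left, Set.mem_insert_iff, Set.mem_singleton_iff,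
        Sym2.eq_swap (a := b) (b := x), Sym2.eq_swap (a := d) (b := w)]
      tauto
  have hsub : G.fourCycleSets ⊆ lift '' (G.induce ({w}ᶜ : Set V)).fourCycleSets ∪
      star '' (T : Set (Σ _ : V, Finset V)) := by
    rintro E ⟨a, b, c, d, h, rfl⟩
    by_cases ha : a = w
    · subst ha; exact Or.inr (key h)
    by_cases hb : b = w
    · subst hb
      rw [← fourCycleEdges_rotate]
      exact Or.inr (key h.rotate)
    by_cases hc : c = w
    · subst hc
      rw [← fourCycleEdges_rotate, ← fourCycleEdges_rotate]
      exact Or.inr (key h.rotate.rotate)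
    by_cases hd : d = w
    · subst hd
      rw [← fourCycleEdges_rotate, ← fourCycleEdges_rotate, ← fourCycleEdges_rotate]
      exact Or.inr (key h.rotate.rotate.rotate)
    refine Or.inl ⟨fourCycleEdges ⟨a, ha⟩ ⟨b, hb⟩ ⟨c, hc⟩ ⟨d, hd⟩, ⟨_, _, _, _, ?_, rfl⟩, ?_⟩
    · obtain ⟨h1, h2, h3, h4, h5, h6⟩ := h
      refine ⟨by simpa, by simpa, by simpa, by simpa, ?_, ?_⟩
      · exact fun h => h5 (congrArg Subtype.val h)
      · exact fun h => h6 (congrArg Subtype.val h)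
    · simp [lift, fourCycleEdges, Set.image_insert_eq]
  refine (Set.ncard_le_ncard hsub (Set.toFinite _)).trans ((Set.ncard_union_le _ _).trans ?_)
  refine Nat.add_le_add (Set.ncard_image_le (Set.toFinite _)) ?_
  refine (Set.ncard_image_le (Set.toFinite _)).trans ?_
  rw [Set.ncard_coe_finset, hT]

variable [DecidableRel G.Adj]

theorem ncard_edgeSet_induce_compl_singleton_add (w : V) :
    (G.induce ({w}ᶜ : Set V)).edgeSet.ncard + G.degree w = G.edgeSet.ncard := by
  have h1 := G.card_edgeFinset_induce_compl_singleton w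
  rw [card_edgeFinset_deleteIncidenceSet] at h1
  have h2 := G.degree_le_card_edgeFinset w
  rw [Set.ncard_eq_toFinset_card', Set.ncard_eq_toFinset_card', ← edgeFinset, ← edgeFinset]
  omega

theorem card_compl_singleton_add_one (w : V) :
    Fintype.card ({w}ᶜ : Set V) + 1 = Fintype.card V := by
  have h : 0 < Fintype.card V := Fintype.card_pos_iff.2 ⟨w⟩
  rw [Fintype.card_compl_set, Set.card_singleton]
  omega

theorem Adj.card_commonNbrs_add_one_le_degree {w x : V} (h : G.Adj w x) :
    (G.commonNbrs w x).card + 1 ≤ G.degree w := by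
  have hx : x ∉ G.commonNbrs w x := fun hx => (mem_commonNbrs.1 hx).2.ne rfl
  rw [← card_neighborFinset_eq_degree, ← Finset.card_insert_of_notMem hx]
  refine Finset.card_le_card fun y hy => ?_
  rw [Finset.mem_insert] at hy
  rcases hy with rfl | hy
  · simpa using h
  · simpa using (mem_commonNbrs.1 hy).1

theorem erase_eq_neighborFinset_union (w : V) :
    Finset.univ.erase w = G.neighborFinset w ∪ ({x | x ≠ w ∧ ¬ G.Adj w x} : Finset V) := by
  ext x
  simp only [Finset.mem_erase, Finset.mem_univ, and_true, Finset.mem_union, mem_neighborFinset,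
    Finset.mem_filter, true_and]
  constructor
  · tauto
  · rintro (h | h)
    · exact h.ne'
    · exact h.1

theorem disjoint_neighborFinset_filter (w : V) :
    Disjoint (G.neighborFinset w) ({x | x ≠ w ∧ ¬ G.Adj w x} : Finset V) := by
  rw [Finset.disjoint_left]
  intro x hx hx'
  rw [mem_neighborFinset] at hx
  simp only [Finset.mem_filter, Finset.mem_univ, true_and] at hx'
  exact hx'.2 hx

/-- Write `k` for the degree of `w` and `c(x)` for the number of common neighbours of `w` and `x`.
Then `c(x) ≤ k - 1` for neighbours `x` and `c(x) ≤ k` otherwise, which makes the sum of `c(x)(c(x) -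
1)` linear in the `c(x)`. Double counting paths of length 2 from `w` expresses `2(e + 1 - d)` as the
sum of all `c(x)`, `x ≠ w`, plus the sum of `deg x - 2` over non-neighbours; `h` is the remaining
inequality. -/
theorem two_mul_sum_choose_two_le {w : V} (hk : 1 ≤ G.degree w)
    (h : 0 ≤ ∑ x ∈ G.neighborFinset w, ((G.commonNbrs w x).card : ℤ) + ((G.degree w : ℤ) - 1) *
      (∑ x with x ≠ w ∧ ¬ G.Adj w x, ((G.degree x : ℤ) - 2) - G.degree w)) :
    2 * ∑ x ∈ Finset.univ.erase w, ((G.commonNbrs w x).card.choose 2 : ℤ) +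
        G.degree w * (G.degree w - 1) ≤
      2 * (G.degree w - 1) * (G.edgeSet.ncard + 1 - Fintype.card V) := by
  set k : ℤ := (G.degree w : ℤ) with hkdef
  have hk' : 1 ≤ k := by rw [hkdef]; exact_mod_cast hk
  set N := G.neighborFinset w with hN
  set O : Finset V := {x | x ≠ w ∧ ¬ G.Adj w x} with hO
  have hdisj : Disjoint N O := G.disjoint_neighborFinset_filter w
  have hsplit : ∀ f : V → ℤ, ∑ x ∈ Finset.univ.erase w, f x = ∑ x ∈ N, f x + ∑ x ∈ O, f x :=
    fun f => by rw [G.erase_eq_neighborFinset_union w, Finset.sum_union hdisj]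
  have hsplit' : ∀ f : V → ℤ, ∑ x, f x = f w + (∑ x ∈ N, f x + ∑ x ∈ O, f x) := fun f => by
    rw [← hsplit, Finset.add_sum_erase _ _ (Finset.mem_univ w)]
  have hNcard : (N.card : ℤ) = k := by rw [hN, card_neighborFinset_eq_degree]
  have hVcard : (Fintype.card V : ℤ) = 1 + (k + O.card) := by
    have := hsplit' fun _ => 1
    simpa [hNcard] using this
  have hdeg : (2 * G.edgeSet.ncard : ℤ) =
      k + (∑ x ∈ N, (G.degree x : ℤ) + ∑ x ∈ O, (G.degree x : ℤ)) := by
    rw [← hsplit' fun x => (G.degree x : ℤ), Set.ncard_eq_toFinset_card', ← edgeFinset]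
    exact_mod_cast G.sum_degrees_eq_twice_card_edges.symm
  have hcommon : ∑ x ∈ N, (G.degree x : ℤ) = k + (∑ x ∈ N, ((G.commonNbrs w x).card : ℤ) +
      ∑ x ∈ O, ((G.commonNbrs w x).card : ℤ)) := by
    have h1 := hsplit' fun x => ((G.commonNbrs w x).card : ℤ)
    simp only [card_commonNbrs_self] at h1
    rw [← h1, hN]
    exact_mod_cast (G.sum_card_commonNbrs w).symm
  have hOsum : ∑ x ∈ O, ((G.degree x : ℤ) - 2) = ∑ x ∈ O, (G.degree x : ℤ) - 2 * O.card := by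
    rw [Finset.sum_sub_distrib, Finset.sum_const, nsmul_eq_mul]; ring
  have hboundN : ∑ x ∈ N, 2 * ((G.commonNbrs w x).card.choose 2 : ℤ) ≤
      (k - 2) * ∑ x ∈ N, ((G.commonNbrs w x).card : ℤ) := by
    rw [Finset.mul_sum]
    refine Finset.sum_le_sum fun x hx => ?_
    rw [two_mul_choose_two, mul_comm]
    refine mul_le_mul_of_nonneg_right ?_ (by positivity)
    have := Adj.card_commonNbrs_add_one_le_degree ((G.mem_neighborFinset w x).1 hx)
    omega
  have hboundO : ∑ x ∈ O, 2 * ((G.commonNbrs w x).card.choose 2 : ℤ) ≤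
      (k - 1) * ∑ x ∈ O, ((G.commonNbrs w x).card : ℤ) := by
    rw [Finset.mul_sum]
    refine Finset.sum_le_sum fun x _ => ?_
    rw [two_mul_choose_two, mul_comm]
    refine mul_le_mul_of_nonneg_right ?_ (by positivity)
    have := G.card_commonNbrs_le_degree w x
    omega
  rw [Finset.mul_sum, hsplit]
  rw [hOsum] at h
  have hfinal : (k - 1) * (2 * (G.edgeSet.ncard : ℤ)) = (k - 1) * (k + (k +
      (∑ x ∈ N, ((G.commonNbrs w x).card : ℤ) + ∑ x ∈ O, ((G.commonNbrs w x).card : ℤ)) +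
      ∑ x ∈ O, (G.degree x : ℤ))) := by rw [hdeg, hcommon]
  rw [hVcard]
  linarith

/-- Deleting `w` of degree `k` lowers the cyclomatic number `M` by `k - 1`, hence twice the binomial
by `(k - 1)(2M - k)`, which is what `two_mul_sum_choose_two_le` provides. -/
theorem FourCycleBound.of_induce_compl_singleton {w : V}
    (hconn : (G.induce ({w}ᶜ : Set V)).Connected) (hk : 1 ≤ G.degree w)
    (hB : (G.induce ({w}ᶜ : Set V)).FourCycleBound)
    (h : 0 ≤ ∑ x ∈ G.neighborFinset w, ((G.commonNbrs w x).card : ℤ) + ((G.degree w : ℤ) - 1) *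
      (∑ x with x ≠ w ∧ ¬ G.Adj w x, ((G.degree x : ℤ) - 2) - G.degree w)) :
    G.FourCycleBound := by
  have h1 := two_mul_sum_choose_two_le hk h
  have h2 := G.fourCycleCount_le_induce_add w
  have h3 := card_le_ncard_edgeSet_add_one hconn
  have h4 := G.ncard_edgeSet_induce_compl_singleton_add w
  have h5 := card_compl_singleton_add_one w
  unfold FourCycleBound at *
  obtain ⟨m, hm⟩ := Nat.exists_eq_add_of_le h3
  obtain ⟨k, hk⟩ := Nat.exists_eq_add_of_le hk
  have h6 : (G.induce ({w}ᶜ : Set V)).edgeSet.ncard + 1 - Fintype.card ({w}ᶜ : Set V) = m := by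
    omega
  have h7 : G.edgeSet.ncard + 1 - Fintype.card V = m + k := by omega
  have h8 : (G.edgeSet.ncard : ℤ) + 1 - Fintype.card V = m + k := by omega
  rw [h6] at hB
  rw [h8, hk] at h1
  rw [h7]
  have h9 := two_mul_choose_two m
  have h10 := two_mul_choose_two (m + k)
  push_cast at h1 h10
  zify at hB h2 ⊢
  nlinarith

theorem FourCycleBound.of_induce_compl_singleton_of_forall_not_isFourCycle {w : V}
    (hk : 1 ≤ G.degree w) (hB : (G.induce ({w}ᶜ : Set V)).FourCycleBound)
    (h : ∀ b x d, ¬ G.IsFourCycle w b x d) : G.FourCycleBound := by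
  have h2 := G.fourCycleCount_le_induce_add w
  have h4 := G.ncard_edgeSet_induce_compl_singleton_add w
  have h5 := card_compl_singleton_add_one w
  rw [Finset.sum_eq_zero, add_zero] at h2
  · unfold FourCycleBound at *
    exact h2.trans (hB.trans (Nat.choose_le_choose 2 (by omega)))
  · intro x hx
    refine Nat.choose_eq_zero_of_lt ?_
    by_contra! hcard
    obtain ⟨b, hb, d, hd, hbd⟩ := Finset.one_lt_card.1 hcard
    exact h b x d (.of_mem_commonNbrs (Finset.ne_of_mem_erase hx).symm hb hd hbd)

end VertexDeletion

/-! ### Choosing the vertex to delete -/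

section Main

variable {V : Type*} [Fintype V] [DecidableEq V] {G : SimpleGraph V} [DecidableRel G.Adj]

/-- If every edge on a `4`-cycle has at least three common neighbours and every vertex that is not
a cut vertex lies on a `4`-cycle, then some non-cut vertex satisfies the degree condition of
`FourCycleBound.of_induce_compl_singleton`. -/
theorem Connected.exists_nonCut_degree_condition [Nontrivial V] (hG : G.Connected)
    (hδ : 2 ≤ G.minDegree)
    (hK : ∀ u v y x, G.IsFourCycle u v y x → 3 ≤ (G.commonNbrs u v).card)
    (hZ : ∀ z, (G.induce ({z}ᶜ : Set V)).Connected → ∃ b x d, G.IsFourCycle z b x d) :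
    ∃ w, (G.induce ({w}ᶜ : Set V)).Connected ∧
      0 ≤ ∑ x ∈ G.neighborFinset w, ((G.commonNbrs w x).card : ℤ) + ((G.degree w : ℤ) - 1) *
        (∑ x with x ≠ w ∧ ¬ G.Adj w x, ((G.degree x : ℤ) - 2) - G.degree w) := by
  classical
  have hfar : ∀ w, ∃ x, x ≠ w ∧ ∀ y, G.dist w y ≤ G.dist w x := by
    intro w
    obtain ⟨x, -, hx⟩ := Finset.exists_max_image Finset.univ (G.dist w) ⟨w, Finset.mem_univ w⟩
    refine ⟨x, ?_, fun y => hx y (Finset.mem_univ y)⟩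
    rintro rfl
    obtain ⟨y, hy⟩ := exists_ne x
    have h1 := hx y (Finset.mem_univ y)
    have h2 := hG.pos_dist_of_ne hy.symm
    rw [dist_self] at h1
    omega
  have hdeg4 : ∀ {z b x d}, G.IsFourCycle z b x d → 4 ≤ G.degree z := fun {z b x d} h => by
    have h1 := hK _ _ _ _ h
    have h2 := Adj.card_commonNbrs_add_one_le_degree h.1
    omega
  have hdeg2 : ∀ x, 2 ≤ G.degree x := fun x => hδ.trans (G.minDegree_le_degree x)
  obtain ⟨v₀⟩ := hG.nonempty
  obtain ⟨z₀, hz₀, hz₀'⟩ := hfar v₀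
  -- The choice is a non-cut vertex of least degree `k`. Vertices farthest from `w` are non-cut, so
  -- their degree is at least `k`.
  obtain ⟨w, hw, hmin⟩ := Finset.exists_min_image
    ({z | (G.induce ({z}ᶜ : Set V)).Connected} : Finset V) (fun z => G.degree z)
    ⟨z₀, by simpa using hG.induce_compl_singleton_of_dist_le hz₀ hz₀'⟩
  simp only [Finset.mem_filter, Finset.mem_univ, true_and] at hw hmin
  refine ⟨w, hw, ?_⟩
  have hk4 : 4 ≤ G.degree w := by
    obtain ⟨b, x, d, h⟩ := hZ w hw
    exact hdeg4 h
  set O : Finset V := {x | x ≠ w ∧ ¬ G.Adj w x} with hO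
  have hmemO : ∀ x, x ∈ O ↔ x ≠ w ∧ ¬ G.Adj w x := by simp [hO]
  have hdistO : ∀ x, x ∈ O ↔ 2 ≤ G.dist w x := by
    intro x
    rw [hmemO]
    constructor
    · rintro ⟨h1, h2⟩
      exact hG.one_lt_dist_of_ne_of_not_adj h1.symm h2
    · intro h
      constructor
      · rintro rfl; simp at h
      · intro hadj; rw [dist_eq_one_iff_adj.2 hadj] at h; omega
  have hfarmin : ∀ x, x ≠ w → (∀ y, G.dist w y ≤ G.dist w x) → G.degree w ≤ G.degree x :=
    fun x hx h => hmin x (hG.induce_compl_singleton_of_dist_le hx h)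
  have hOnonneg : ∀ x ∈ O, (0 : ℤ) ≤ (G.degree x : ℤ) - 2 := fun x _ => by
    have := hdeg2 x
    omega
  have hNnonneg : (0 : ℤ) ≤ ∑ x ∈ G.neighborFinset w, ((G.commonNbrs w x).card : ℤ) :=
    Finset.sum_nonneg fun x _ => Int.natCast_nonneg _
  rcases O.eq_empty_or_nonempty with hOe | hOne
  -- If `w` is adjacent to all, every other vertex is farthest, has degree at least `k`, and shares
  -- at least `k - 1` neighbours with `w`.
  · have hadj : ∀ x, x ≠ w → G.Adj w x := fun x hx => by
      by_contra h
      have := (hmemO x).2 ⟨hx, h⟩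
      simp [hOe] at this
    have hcommon : ∀ x ∈ G.neighborFinset w,
        (G.degree w : ℤ) - 1 ≤ ((G.commonNbrs w x).card : ℤ) := by
      intro x hx
      rw [mem_neighborFinset] at hx
      have h1 : G.degree w ≤ G.degree x := hfarmin x hx.ne' fun y => by
        rw [dist_eq_one_iff_adj.2 hx]
        by_cases hy : y = w
        · simp [hy]
        · exact (dist_eq_one_iff_adj.2 (hadj y hy)).le
      have h2 : (G.neighborFinset x).erase w ⊆ G.commonNbrs w x := fun y hy => by
        rw [Finset.mem_erase, mem_neighborFinset] at hy
        exact mem_commonNbrs.2 ⟨hadj y hy.1, hy.2⟩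
      have h3 := Finset.card_le_card h2
      rw [Finset.card_erase_of_mem (by simpa using hx.symm), card_neighborFinset_eq_degree] at h3
      omega
    have hsum := Finset.card_nsmul_le_sum _ _ _ hcommon
    rw [card_neighborFinset_eq_degree, nsmul_eq_mul] at hsum
    rw [hOe, Finset.sum_empty]
    linarith
  obtain ⟨z, hzw, hzfar⟩ := hfar w
  have hzO : z ∈ O := by
    obtain ⟨y, hy⟩ := hOne
    exact (hdistO z).2 (((hdistO y).1 hy).trans (hzfar y))
  have hzk := hfarmin z hzw hzfar
  -- Such a `y` contributes at least 2 and `z` at least `k - 2`, together the required `k`.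
  by_cases hex : ∃ y ∈ O, y ≠ z ∧ 4 ≤ G.degree y
  · obtain ⟨y, hyO, hyz, hy4⟩ := hex
    have hsub : ({y, z} : Finset V) ⊆ O := by
      intro t ht
      rw [Finset.mem_insert, Finset.mem_singleton] at ht
      rcases ht with rfl | rfl
      · exact hyO
      · exact hzO
    have h1 := Finset.sum_le_sum_of_subset_of_nonneg hsub fun x hx _ => hOnonneg x hx
    rw [Finset.sum_pair hyz] at h1
    refine add_nonneg hNnonneg (mul_nonneg (by omega) ?_)
    omega
  · push Not at hex
    obtain ⟨b, x, d, hcyc⟩ := hZ z (hG.induce_compl_singleton_of_dist_le hzw hzfar)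
    -- The neighbour `b` of `z` on a 4-cycle has degree at least 4, so it cannot lie in `O`. Hence
    -- all of `O` is at distance 2 and farthest, so of degree at least `k ≥ 4`, leaving only `z`.
    have hz2 : G.dist w z = 2 := by
      refine le_antisymm ?_ ((hdistO z).1 hzO)
      by_contra! hlt
      have h1 := hG.dist_triangle (u := w) (v := b) (w := z)
      rw [dist_eq_one_iff_adj.2 hcyc.1.symm] at h1
      have h2 := hex b ((hdistO b).2 (by omega)) hcyc.1.ne'
      have h3 := hdeg4 hcyc.reflect
      omega
    have hOz : ∀ y ∈ O, y = z := by
      intro y hy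
      by_contra hyz
      have h1 := (hdistO y).1 hy
      have h2 := hfarmin y ((hmemO y).1 hy).1 fun t => by
        have := hzfar t
        omega
      have h3 := hex y hy hyz
      omega
    have hNz : G.neighborFinset z = G.neighborFinset w := by
      refine Finset.eq_of_subset_of_card_le ?_ (by simpa using hzk)
      intro t ht
      rw [mem_neighborFinset] at ht ⊢
      by_contra hwt
      by_cases htw : t = w
      · subst htw
        exact ((hmemO z).1 hzO).2 ht.symm
      · exact ht.ne (hOz t ((hmemO t).2 ⟨htw, hwt⟩)).symm
    -- Since `w` and `z` have the same neighbours, each edge `wt` lies on a 4-cycle `w t z s`. The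
    -- resulting `3k` outweighs the deficit of at most `2(k - 1)`.
    have hcommon : ∀ t ∈ G.neighborFinset w, (3 : ℤ) ≤ ((G.commonNbrs w t).card : ℤ) := by
      intro t ht
      obtain ⟨s, hs, hst⟩ := Finset.exists_mem_ne
        (by rw [card_neighborFinset_eq_degree]; omega : 1 < (G.neighborFinset w).card) t
      have hmem : ∀ r ∈ G.neighborFinset w, r ∈ G.commonNbrs w z := fun r hr =>
        mem_commonNbrs.2 ⟨by simpa using hr, by rw [← hNz] at hr; simpa using hr⟩
      exact_mod_cast hK _ _ _ _ (.of_mem_commonNbrs hzw.symm (hmem t ht) (hmem s hs) hst.symm)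
    have hsum := Finset.card_nsmul_le_sum _ _ _ hcommon
    rw [card_neighborFinset_eq_degree, nsmul_eq_mul] at hsum
    have hOsum := Finset.single_le_sum hOnonneg hzO
    nlinarith

theorem Connected.fourCycleBound_of_deletions (hG : G.Connected) (hodd : G.HasOddCycle)
    (hδ : 2 ≤ G.minDegree)
    (hvertex : ∀ v : V, (G.induce ({v}ᶜ : Set V)).Connected →
      (G.induce ({v}ᶜ : Set V)).HasOddCycle → (G.induce ({v}ᶜ : Set V)).FourCycleBound)
    (hedge : ∀ s ∈ G.edgeSet, (G.deleteEdges {s}).Connected →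
      (G.deleteEdges {s}).HasOddCycle → (G.deleteEdges {s}).FourCycleBound) :
    G.FourCycleBound := by
  rcases hG.fourCycleBound_or_commonNbrs hodd hedge with h | hK
  · exact h
  by_contra hno
  have hex : ∃ a b c d, G.IsFourCycle a b c d := by
    by_contra! h
    exact hno (.of_forall_not_isFourCycle h)
  obtain ⟨a, b, c, d, habcd⟩ := hex
  have : Nontrivial V := ⟨a, b, habcd.1.ne⟩
  -- The vertices `a`, `b`, `p`, `q` span a `K₄`, which keeps a triangle after any vertex is
  -- deleted.
  obtain ⟨⟨p, q⟩, hpq⟩ := (hK a b c d habcd).2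
  simp only [commonAdjPairs, Finset.mem_filter, Finset.mem_univ, true_and, mem_commonNbrs] at hpq
  obtain ⟨⟨hap, hbp⟩, ⟨haq, hbq⟩, hpq⟩ := hpq
  have hB : ∀ z, (G.induce ({z}ᶜ : Set V)).Connected →
      (G.induce ({z}ᶜ : Set V)).FourCycleBound := fun z hz => hvertex z hz
    (hasOddCycle_induce_compl_singleton_of_isClique habcd.1 hap haq hbp hbq hpq z)
  have hdeg : ∀ z, 1 ≤ G.degree z := fun z => by
    have := G.minDegree_le_degree z
    omega
  have hZ : ∀ z, (G.induce ({z}ᶜ : Set V)).Connected → ∃ b x d, G.IsFourCycle z b x d := by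
    intro z hz
    by_contra! h
    exact hno (.of_induce_compl_singleton_of_forall_not_isFourCycle (hdeg z) (hB z hz) h)
  obtain ⟨w, hw, hcond⟩ :=
    hG.exists_nonCut_degree_condition hδ (fun u v y x h => (hK u v y x h).1) hZ
  exact hno (.of_induce_compl_singleton hw (hdeg w) (hB w hw) hcond)

end Main

end SimpleGraph

theorem proposition2p4 {V : Type*} [Fintype V] [DecidableEq V]
    (G : SimpleGraph V) [DecidableRel G.Adj] (d e δ Δ : ℕ)
    (hd : d = Fintype.card V) (he : e = G.edgeSet.ncard)
    (hδ : δ = G.minDegree) (hΔ : Δ = G.maxDegree)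
    (hconn : G.Connected) (hodd : G.HasOddCycle)
    (hd6 : 6 ≤ d) (hδ2 : 2 ≤ δ)
    (hvertex : ∀ v : V, (G.induce ({v}ᶜ : Set V)).Connected →
      (G.induce ({v}ᶜ : Set V)).HasOddCycle → (G.induce ({v}ᶜ : Set V)).FourCycleBound)
    (hedge : ∀ s ∈ G.edgeSet, (G.deleteEdges {s}).Connected →
      (G.deleteEdges {s}).HasOddCycle → (G.deleteEdges {s}).FourCycleBound)
    (hcases :
      Δ = d - 1 ∨
      (3 ≤ δ ∧ (e : ℤ) < (δ : ℤ) * ((d : ℤ) - (δ : ℤ))) ∨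
      (e : ℝ) ≥ (((δ : ℝ) + 2) * (d : ℝ) - (3 * (δ : ℝ) + 1)) / 2
        + 1 / (2 * ((δ : ℝ) - 1)) ∨
      δ ≤ 3) :
    G.fourCycleCount ≤ (e + 1 - d).choose 2 := by
  subst hd he hδ
  exact hconn.fourCycleBound_of_deletions hodd hδ2 hvertex hedge
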